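/- For integers $n\ge 0$ and $r\ge 1$ let $$C(n,r)=\left\{\sum_{i=1}^{r}\binom{n_i}{2}:\ n_1,\dots,n_r\in\mathbb{Z}_{\ge 0},\ \sum_{i=1}^{r}n_i=n\right\},$$ that is, the set of all possible numbers of edges of an $n$-vertex graph that is a vertex-disjoint union of at most $r$ cliques. Then for every fixed integer $r\ge 5$, $$|C(n,r)|=\frac{n^2}{2}-\frac{n^2}{2r}+o(n^2)\qquad\text{as } n\to\infty.$$ -/

import Mathlib

open Asymptotics Filter

/-- `C(n, r)`: the set of all sums `∑ i, (nᵢ choose 2)` over `r` non-negative integers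
`n₁, …, n_r` with `∑ i, nᵢ = n`. -/
def cliqueEdgeCounts (n r : ℕ) : Set ℕ :=
  {e | ∃ a : Fin r → ℕ, ∑ i, a i = n ∧ ∑ i, (a i).choose 2 = e}

/-- `C(n, r)` is finite, so that its `Set.ncard` is its actual number of elements. -/
theorem cliqueEdgeCounts_finite (n r : ℕ) : (cliqueEdgeCounts n r).Finite := by
  refine ((Finset.piAntidiag Finset.univ n).image
    fun a : Fin r → ℕ => ∑ i, (a i).choose 2).finite_toSet.subset ?_
  rintro e ⟨a, ha, rfl⟩
  exact Finset.mem_coe.2 (Finset.mem_image.2 ⟨a, by simp [ha], rfl⟩)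

/-!
A sum `∑ nᵢ.choose 2` with `∑ nᵢ = n` equals `(s - n) / 2`, where `s = ∑ nᵢ²`. So `C(n, r)` counts the
sums of squares `s` of `r` non-negative integers with sum `n`. Such an `s` is congruent to `n` modulo
`2` and satisfies `n² / r ≤ s ≤ n²`, which gives the upper bound. For the lower bound,
almost all `s` that meet these conditions occur (`representsInterior_of_five_le`): for every `ε > 0`
and large `n`, all those between `(1 / r + ε) n²` and `(1 - ε) n²`.

For `r = 5` this follows from Cauchy's lemma (`cauchy_lemma`): if `a` and `b ≥ 0` are odd,
`b² < 4 a` and `3 a < b² + 2 b + 4`, then four non-negative integers have sum `b` and sum of squares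
`a`. The fifth integer `m` is chosen so that `b = n - m` and `a = s - m²` meet the conditions. The step
from `r` to `r + 1` adds either `0` or `⌊n / (r + 1)⌋`.

Cauchy's lemma rests on the theorem that every `n ≡ 3 (mod 8)` is a sum of three squares
(`sum_three_squares_of_mod_eight_eq_three`). It is proved in the classical way: Dirichlet's theorem on
primes in arithmetic progressions and quadratic reciprocity give a positive definite ternary form
of determinant `1` that represents `n`, and Gauss's reduction shows that such a form is equivalent
to `x² + y² + z²` (`ternary_form_sum_three_squares`).
-/

/-! ### Sums of three squares -/

/-- Every residue class modulo `a` has a representative of absolute value at most `a / 2`. -/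
theorem Int.exists_four_mul_sq_add_mul_le (x : ℤ) {a : ℤ} (ha : 0 < a) :
    ∃ k : ℤ, 4 * (x + k * a) ^ 2 ≤ a ^ 2 := by
  refine ⟨-((2 * x + a) / (2 * a)), ?_⟩
  have h1 := Int.emod_nonneg (2 * x + a) (b := 2 * a) (by omega)
  have h2 := Int.emod_lt_of_pos (2 * x + a) (b := 2 * a) (by omega)
  have h3 := Int.emod_add_mul_ediv (2 * x + a) (2 * a)
  generalize (2 * x + a) / (2 * a) = q at *
  generalize (2 * x + a) % (2 * a) = t at *
  have : (2 * (x + -q * a)) = t - a := by linarith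
  calc 4 * (x + -q * a) ^ 2 = (2 * (x + -q * a)) ^ 2 := by ring
    _ = (t - a) ^ 2 := by rw [this]
    _ ≤ a ^ 2 := by nlinarith

/-- A positive definite integral ternary form `a x² + b y² + c z² + 2d yz + 2e xz + 2f xy` of
determinant `1` takes only values that are sums of three squares, because it is equivalent to
`x² + y² + z²`. Positive definiteness is given by the leading minors `a` and `D = a b - f²`.

The proof is Gauss's reduction, as an induction on `(a, D)` in the lexicographic order: a unimodular
change of the first two variables lowers `a` unless `3 a² ≤ 4 D`, and one of the last two lowers `D`
and keeps `a` unless `3 D² ≤ 4 a`. The two inequalities together force `a = D = 1`. -/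
theorem ternary_form_sum_three_squares (A B : ℕ) : ∀ a b c d e f : ℤ,
    a = A → a * b - f ^ 2 = B → 0 < a → 0 < a * b - f ^ 2 →
    a * b * c + 2 * d * e * f - a * d ^ 2 - b * e ^ 2 - c * f ^ 2 = 1 →
    ∀ x y z : ℤ, ∃ u v w : ℤ,
      a * x ^ 2 + b * y ^ 2 + c * z ^ 2 + 2 * d * y * z + 2 * e * x * z + 2 * f * x * y
        = u ^ 2 + v ^ 2 + w ^ 2 := by
  induction A using Nat.strong_induction_on generalizing B with
  | _ A ihA =>
  induction B using Nat.strong_induction_on with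
  | _ B ihB =>
  intro a b c d e f hA hB ha hD hdet x y z
  -- `D, M, N` are the coefficients of the binary form in `y, z` that is left when the square is
  -- completed in `x`, multiplied by `a`; its discriminant `D N - M²` is `a` times the determinant.
  obtain ⟨D, hDdef⟩ : ∃ D, D = a * b - f ^ 2 := ⟨_, rfl⟩
  obtain ⟨M, hM⟩ : ∃ M, M = a * d - e * f := ⟨_, rfl⟩
  obtain ⟨N, hN⟩ : ∃ N, N = a * c - e ^ 2 := ⟨_, rfl⟩
  have hDMN : D * N - M ^ 2 = a := by
    subst hDdef hM hN; linear_combination a * hdet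
  rw [← hDdef] at hD hB
  -- The new basis is `e₂ + k e₁, e₁, e₃`.
  by_cases h1 : 4 * D < 3 * a ^ 2
  · obtain ⟨k, hk⟩ := Int.exists_four_mul_sq_add_mul_le f ha
    have haa : (b + 2 * k * f + k ^ 2 * a) * a = D + (f + k * a) ^ 2 := by
      subst hDdef; ring
    have hpos : 0 < b + 2 * k * f + k ^ 2 * a := by
      refine pos_of_mul_pos_left (b := a) ?_ ha.le
      rw [haa]; positivity
    have hlt : b + 2 * k * f + k ^ 2 * a < a := by
      refine lt_of_mul_lt_mul_right (a := a) ?_ ha.le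
      rw [haa]; nlinarith
    obtain ⟨A', hA'⟩ := Int.eq_ofNat_of_zero_le hpos.le
    have hD' : (b + 2 * k * f + k ^ 2 * a) * a - (f + k * a) ^ 2 = D := by rw [haa]; ring
    obtain ⟨u, v, w, h⟩ := ihA A' (by omega) B _ a c e (d + k * e) (f + k * a) hA'
      (by rw [hD', hB]) hpos (by rw [hD']; exact hD) (by linear_combination hdet)
      y (x - k * y) z
    exact ⟨u, v, w, by rw [← h]; ring⟩
  -- The new basis is `e₁, e₃ + k e₂, e₂`.
  by_cases h2 : 4 * a < 3 * D ^ 2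
  · obtain ⟨k, hk⟩ := Int.exists_four_mul_sq_add_mul_le M hD
    have hD' : a * (c + 2 * k * d + k ^ 2 * b) - (e + k * f) ^ 2 = N + 2 * k * M + k ^ 2 * D := by
      subst hDdef hM hN; ring
    have hDD : (N + 2 * k * M + k ^ 2 * D) * D = a + (M + k * D) ^ 2 := by
      linear_combination hDMN
    have hpos : 0 < N + 2 * k * M + k ^ 2 * D := by
      refine pos_of_mul_pos_left (b := D) ?_ hD.le
      rw [hDD]; positivity
    have hlt : N + 2 * k * M + k ^ 2 * D < D := by
      refine lt_of_mul_lt_mul_right (a := D) ?_ hD.le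
      rw [hDD]; nlinarith
    obtain ⟨B', hB'⟩ := Int.eq_ofNat_of_zero_le hpos.le
    obtain ⟨u, v, w, h⟩ := ihB B' (by omega) a (c + 2 * k * d + k ^ 2 * b) b (d + k * b) f
      (e + k * f) hA (by rw [hD', hB']) ha (by rw [hD']; exact hpos)
      (by linear_combination hdet) x z (y - k * z)
    exact ⟨u, v, w, by rw [← h]; ring⟩
  have ha2 : a < 2 := by
    by_contra! h
    nlinarith [mul_pos ha ha, mul_pos ha hD, mul_pos hD hD, sq_nonneg (a - D)]
  obtain rfl : a = 1 := by omega
  have hD2 : D < 2 := by nlinarith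
  obtain rfl : D = 1 := by omega
  refine ⟨x + f * y + e * z, y + M * z, z, ?_⟩
  have hb : b = 1 + f ^ 2 := by linarith
  have hc : c = 1 + M ^ 2 + e ^ 2 := by linarith
  have hd : d = M + e * f := by linarith
  rw [hb, hc, hd]; ring

open scoped NumberTheorySymbols in
/-- The case `n ≡ 3 (mod 8)` of the three-square theorem (Gauss, Legendre), after Dirichlet: `n` is the
value at `(0, 0, 1)` of a form with matrix `!![a, t, 1; t, 2p, 0; 1, 0, n]` of determinant `1`. With
`d = a * 2p - t²` the determinant condition reads `2p + 1 = d n`, so it is enough that `p` is a prime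
for which `-d` is a square modulo `2p`. -/
theorem sum_three_squares_of_mod_eight_eq_three (n : ℕ) (hn : n % 8 = 3) :
    ∃ u v w : ℤ, (n : ℤ) = u ^ 2 + v ^ 2 + w ^ 2 := by
  obtain ⟨j, rfl⟩ : ∃ j, n = 2 * j + 1 := ⟨n / 2, by omega⟩
  have hj : j % 4 = 1 := by omega
  have hcop : j.Coprime (4 * (2 * j + 1)) := by
    refine Nat.Coprime.mul_right ?_ ?_
    · have : Nat.Coprime j 2 := (Nat.coprime_two_right).2 (Nat.odd_iff.2 (by omega))
      exact Nat.Coprime.pow_right 2 this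
    · simp
  -- Dirichlet's theorem gives a prime `p ≡ (n - 1) / 2 (mod 4n)`, for which `d ≡ 1 (mod 8)` and
  -- `p ≡ 1 (mod 4)`.
  obtain ⟨p, hp, hprime, hmod⟩ :=
    Nat.forall_exists_prime_gt_and_modEq j (q := 4 * (2 * j + 1)) (by omega) hcop
  obtain ⟨v, hv⟩ := (Nat.modEq_iff_dvd' hp.le).1 hmod.symm
  obtain ⟨d, hd⟩ : ∃ d, d = 8 * v + 1 := ⟨_, rfl⟩
  have hpd : 2 * p + 1 = d * (2 * j + 1) := by
    have : p = 4 * (2 * j + 1) * v + j := by omega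
    rw [this, hd]; ring
  have hp4 : p % 4 = 1 := by
    have : p = 4 * ((2 * j + 1) * v) + j := by
      have : p = 4 * (2 * j + 1) * v + j := by omega
      rw [this]; ring
    omega
  have hpodd : Odd p := Nat.odd_iff.2 (by omega)
  have hdodd : Odd d := Nat.odd_iff.2 (by omega)
  have : Fact p.Prime := ⟨hprime⟩
  have hJ2 : J(-2 | d) = 1 := by
    rw [jacobiSym.at_neg_two hdodd, ZMod.χ₈'_nat_eq_if_mod_eight]
    rw [if_neg (by omega), if_pos (by omega)]
  have hJ : J(-(d : ℤ) | p) = 1 := by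
    rw [jacobiSym.neg _ hpodd, ZMod.χ₄_nat_one_mod_four hp4, one_mul,
      jacobiSym.quadratic_reciprocity_one_mod_four' hdodd hp4]
    -- `-2p = 1 - d n ≡ 1 (mod d)`, and `J(-2 | d) = 1`.
    have : J(-2 * (p : ℤ) | d) = J(1 | d) := by
      apply jacobiSym.mod_left'
      have : -2 * (p : ℤ) = 1 + d * (-(2 * j + 1)) := by
        have : (2 * p + 1 : ℤ) = d * (2 * j + 1) := by exact_mod_cast hpd
        linarith
      rw [this, Int.add_mul_emod_self_left]
    rw [jacobiSym.mul_left, hJ2, one_mul, jacobiSym.one_left] at this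
    exact this
  have hsq := ZMod.isSquare_of_jacobiSym_eq_one hJ
  obtain ⟨y, hy⟩ := hsq
  -- A root of `t² = -d` modulo `p` is made odd, so that it is a root modulo `2p`.
  obtain ⟨t, hto, ht⟩ : ∃ t : ℤ, t % 2 = 1 ∧ ((p : ℤ) ∣ t ^ 2 + d) := by
    have key : ∀ t : ℤ, (t : ZMod p) = y → (p : ℤ) ∣ t ^ 2 + d := by
      intro t ht
      rw [← ZMod.intCast_zmod_eq_zero_iff_dvd]
      push_cast at hy ⊢
      rw [ht, pow_two, ← hy]; ring
    rcases Int.emod_two_eq_zero_or_one (y.val : ℤ) with h | h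
    · refine ⟨y.val + p, by omega, key _ (by simp)⟩
    · exact ⟨y.val, h, key _ (by simp)⟩
  have h2 : (2 * p : ℤ) ∣ t ^ 2 + d := by
    refine IsCoprime.mul_dvd ?_ ?_ ht
    · exact_mod_cast (Nat.coprime_two_left).2 hpodd
    · have : t ^ 2 % 2 = 1 := by rw [pow_two, Int.mul_emod, hto]; rfl
      omega
  obtain ⟨a, ha⟩ := h2
  have hpd' : (2 * p + 1 : ℤ) = d * (2 * j + 1) := by exact_mod_cast hpd
  have hdpos : (0 : ℤ) < d := by omega
  have hppos : (0 : ℤ) < 2 * p := by have := hprime.pos; omega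
  have hapos : 0 < a := by
    refine pos_of_mul_pos_right (b := a) (a := 2 * (p : ℤ)) ?_ hppos.le
    rw [← ha]; positivity
  have hD : a * (2 * p) - t ^ 2 = d := by linarith
  obtain ⟨A, hA⟩ := Int.eq_ofNat_of_zero_le hapos.le
  obtain ⟨u, v, w, h⟩ := ternary_form_sum_three_squares A d a (2 * p) (2 * j + 1) 0 1 t hA hD hapos
    (by rw [hD]; exact hdpos) (by linear_combination (2 * j + 1 : ℤ) * hD - hpd') 0 0 1
  exact ⟨u, v, w, by rw [← h]; push_cast; ring⟩

/-! ### Cauchy's lemma -/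

/-- Cauchy's lemma: under these conditions there are four non-negative integers with sum `b` and sum
of squares `a`. They are the numbers `(b ± x ± y ± z) / 4` with an even number of minus signs, where
`4 a - b² = x² + y² + z²`. -/
theorem cauchy_lemma (a b : ℤ) (ha : Odd a) (hb : Odd b) (hb0 : 0 ≤ b)
    (h1 : b ^ 2 < 4 * a) (h2 : 3 * a < b ^ 2 + 2 * b + 4) :
    ∃ s t u v : ℕ, (s + t + u + v : ℤ) = b ∧ (s ^ 2 + t ^ 2 + u ^ 2 + v ^ 2 : ℤ) = a := by
  obtain ⟨N, hN⟩ := Int.eq_ofNat_of_zero_le (sub_nonneg.2 h1.le)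
  have hb8 : b ^ 2 % 8 = 1 := by
    obtain ⟨k, rfl⟩ := hb
    obtain ⟨l, hl⟩ := Int.even_mul_succ_self k
    have : (2 * k + 1) ^ 2 = 8 * l + 1 := by linear_combination 4 * hl
    omega
  have ha2 := Int.odd_iff.1 ha
  have hb2 := Int.odd_iff.1 hb
  obtain ⟨x, y, z, h⟩ := sum_three_squares_of_mod_eight_eq_three N (by omega)
  have hsum : x ^ 2 + y ^ 2 + z ^ 2 = 4 * a - b ^ 2 := by rw [← h]; exact hN.symm
  have h8 : (x ^ 2 + y ^ 2 + z ^ 2) % 8 = 3 := by omega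
  -- Three squares with sum `3` modulo `8` are squares of odd numbers.
  have hodd : ∀ x y z : ℤ, (x ^ 2 + y ^ 2 + z ^ 2) % 8 = 3 → x % 2 = 1 := by
    intro x y z h
    have hx : x % 2 = 0 ∨ x % 2 = 1 := by omega
    rcases hx with hx | hx
    · exfalso
      obtain ⟨x', rfl⟩ : ∃ x', x = 2 * x' := ⟨x / 2, by omega⟩
      have key : ∀ y : ℤ, y ^ 2 % 4 = 0 ∨ y ^ 2 % 4 = 1 := by
        intro y
        rcases Int.even_or_odd' y with ⟨k, rfl | rfl⟩ <;> ring_nf <;> omega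
      have := key y
      have := key z
      have : (2 * x') ^ 2 = 4 * x' ^ 2 := by ring
      omega
    · exact hx
  have hx := hodd x y z h8
  have hy := hodd y x z (by rw [← h8]; ring_nf)
  have hz := hodd z x y (by rw [← h8]; ring_nf)
  obtain ⟨z', hz', hz'2⟩ : ∃ z', (z' = z ∨ z' = -z) ∧ (b + x + y + z') % 4 = 0 := by
    by_cases h : (b + x + y + z) % 4 = 0
    · exact ⟨z, Or.inl rfl, h⟩
    · exact ⟨-z, Or.inr rfl, by omega⟩
  have hz'' : z' ^ 2 = z ^ 2 := by rcases hz' with rfl | rfl <;> ring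
  rw [← hz''] at hsum
  have hz3 : z' % 2 = 1 := by omega
  clear hz' hz'' hz h h8
  -- As `(x + y + z)² ≤ 3 (4 a - b²) < (b + 4)²`, the four numerators exceed `-4`.
  have bound : ∀ x y z : ℤ, x ^ 2 + y ^ 2 + z ^ 2 = 4 * a - b ^ 2 → -4 < b + x + y + z := by
    intro x y z h
    by_contra! hc
    nlinarith [sq_nonneg (x - y), sq_nonneg (y - z), sq_nonneg (x - z)]
  have b1 := bound x y z' hsum
  have b2 := bound x (-y) (-z') (by rw [← hsum]; ring)
  have b3 := bound (-x) y (-z') (by rw [← hsum]; ring)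
  have b4 := bound (-x) (-y) z' (by rw [← hsum]; ring)
  obtain ⟨s, hs⟩ : ∃ s : ℕ, b + x + y + z' = 4 * s := ⟨((b + x + y + z') / 4).toNat, by omega⟩
  obtain ⟨t, ht⟩ : ∃ s : ℕ, b + x - y - z' = 4 * s := ⟨((b + x - y - z') / 4).toNat, by omega⟩
  obtain ⟨u, hu⟩ : ∃ s : ℕ, b - x + y - z' = 4 * s := ⟨((b - x + y - z') / 4).toNat, by omega⟩
  obtain ⟨v, hv⟩ : ∃ s : ℕ, b - x - y + z' = 4 * s := ⟨((b - x - y + z') / 4).toNat, by omega⟩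
  refine ⟨s, t, u, v, by linarith, ?_⟩
  have : 16 * (s ^ 2 + t ^ 2 + u ^ 2 + v ^ 2 : ℤ) = 16 * a := by
    calc 16 * (s ^ 2 + t ^ 2 + u ^ 2 + v ^ 2 : ℤ)
        = (4 * s) ^ 2 + (4 * t) ^ 2 + (4 * u) ^ 2 + (4 * v) ^ 2 := by ring
      _ = 16 * a := by rw [← hs, ← ht, ← hu, ← hv]; linear_combination 4 * hsum
  linarith

/-! ### Representing an integer as a sum of squares with prescribed sum -/

/-- There are `r` non-negative integers with sum `n` and sum of squares `s`. -/
def IsSumSquaresWithSum (r n s : ℕ) : Prop :=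
  ∃ a : Fin r → ℕ, ∑ i, a i = n ∧ ∑ i, a i ^ 2 = s

theorem IsSumSquaresWithSum.cons {r n s : ℕ} (h : IsSumSquaresWithSum r n s) (m : ℕ) :
    IsSumSquaresWithSum (r + 1) (m + n) (m ^ 2 + s) := by
  obtain ⟨a, h1, h2⟩ := h
  exact ⟨Fin.cons m a, by simp [Fin.sum_univ_succ, h1], by simp [Fin.sum_univ_succ, h2]⟩

/-- For large `n`, every `s ≡ n (mod 2)` between `(1 / r + ε) n²` and `(1 - ε) n²` is the sum of squares
of `r` non-negative integers with sum `n`. Up to `ε`, the two bounds are the Cauchy-Schwarz bound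
and the trivial one, and the congruence is necessary. -/
def RepresentsInterior (r : ℕ) : Prop :=
  ∀ ε : ℝ, 0 < ε → ∀ᶠ n : ℕ in atTop, ∀ s : ℕ, s % 2 = n % 2 →
    (1 / r + ε) * (n : ℝ) ^ 2 ≤ s → (s : ℝ) ≤ (1 - ε) * (n : ℝ) ^ 2 → IsSumSquaresWithSum r n s

theorem isSumSquaresWithSum_four {b a : ℕ} (ha : Odd a) (hb : Odd b)
    (h1 : b ^ 2 < 4 * a) (h2 : 3 * a < b ^ 2 + 2 * b + 4) : IsSumSquaresWithSum 4 b a := by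
  obtain ⟨s, t, u, v, h3, h4⟩ := cauchy_lemma a b (by exact_mod_cast ha) (by exact_mod_cast hb)
    (by positivity) (by exact_mod_cast h1) (by exact_mod_cast h2)
  refine ⟨![s, t, u, v], ?_, ?_⟩
  · simp only [Fin.sum_univ_four]; exact_mod_cast h3
  · simp only [Fin.sum_univ_four]; exact_mod_cast h4

/-- One of the five integers, `m`, is chosen so that the sum `n - m` and the sum of squares `s - m²` of
the other four satisfy the conditions of Cauchy's lemma. With `m = x n`, the admissible `s / n²` fill
the interval from `x² + (1 - x)² / 4` to `x² + (1 - x)² / 3`, and these intervals cover `(1 / 5, 1)`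
as `x` runs over `(1 / 5, 1)`. -/
theorem representsInterior_five : RepresentsInterior 5 := by
  intro ε hε
  have hl : Tendsto (fun n : ℕ => (n : ℝ)) atTop atTop := tendsto_natCast_atTop_atTop
  filter_upwards [hl.eventually_ge_atTop (10 / ε), hl.eventually_ge_atTop 10,
    hl.eventually_ge_atTop (1000 / ε ^ 2)] with n hn1 hn2 hn3 s hpar hlo hhi
  rw [div_le_iff₀ (by positivity)] at hn1 hn3
  have hn10 : 10 ≤ n := by exact_mod_cast hn2
  -- `m` is the largest number of the right parity with `(n - m)² < 4 (s - m²)`; the failure of this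
  -- at `m + 2` yields the other inequality of Cauchy's lemma.
  let P : ℕ → Prop := fun m => m % 2 ≠ n % 2 ∧
    5 * (m : ℝ) ^ 2 - 2 * n * m + (n : ℝ) ^ 2 < 4 * s
  classical
  -- The quadratic `5 m² - 2 n m + n²` has its minimum `4 n² / 5` at `m = n / 5`.
  obtain ⟨m₀, hm₀n, hm₀⟩ : ∃ m₀ ≤ n, P m₀ := by
    have key : ∀ m : ℕ, m % 2 ≠ n % 2 → n / 5 ≤ m → m ≤ n / 5 + 1 → ∃ m₀ ≤ n, P m₀ := by
      intro m hm h1 h2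
      refine ⟨m, by omega, hm, ?_⟩
      have h3 : (5 * m : ℝ) ≤ n + 5 := by exact_mod_cast (by omega : 5 * m ≤ n + 5)
      have h4 : (n : ℝ) ≤ 5 * m + 5 := by exact_mod_cast (by omega : n ≤ 5 * m + 5)
      have h5 : (5 * (m : ℝ) - n) ^ 2 ≤ 25 := by nlinarith
      have h6 : 100 ≤ ε * (n : ℝ) ^ 2 := by nlinarith
      push_cast at hlo
      nlinarith
    by_cases h : n / 5 % 2 = n % 2
    · exact key (n / 5 + 1) (by omega) (by omega) le_rfl
    · exact key (n / 5) h le_rfl (by omega)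
  obtain ⟨m, hm⟩ : ∃ m, m = Nat.findGreatest P n := ⟨_, rfl⟩
  obtain ⟨hmpar, hmP⟩ : P m := hm ▸ Nat.findGreatest_spec hm₀n hm₀
  have hmn : m ≤ n := hm ▸ Nat.findGreatest_le n
  have hmnR : (m : ℝ) ≤ n := by exact_mod_cast hmn
  have hm0 : (0 : ℝ) ≤ m := by positivity
  -- Since `s ≤ (1 - ε) n²`, the number `m` stays away from `n`, so that linear terms are negligible.
  have hgap : ε * n ≤ 2 * ((n : ℝ) - m) := by
    have h1 : 4 * ε * (n : ℝ) ^ 2 ≤ (n - m) * (3 * n + 5 * m) := by nlinarith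
    have h2 : ((n : ℝ) - m) * (3 * n + 5 * m) ≤ (n - m) * (8 * n) :=
      mul_le_mul_of_nonneg_left (by linarith) (by linarith)
    have : (ε * n) * (4 * n) ≤ (2 * ((n : ℝ) - m)) * (4 * n) := by nlinarith
    exact le_of_mul_le_mul_right this (by positivity)
  have hm2 : m + 2 ≤ n := by
    have : (m : ℝ) + 2 ≤ n := by linarith
    exact_mod_cast this
  have hfail : ¬ P (m + 2) := by
    apply Nat.findGreatest_is_greatest (n := n) _ hm2
    omega
  have hfail' : 4 * (s : ℝ) ≤ 5 * ((m : ℝ) + 2) ^ 2 - 2 * n * (m + 2) + (n : ℝ) ^ 2 := by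
    by_contra! h
    exact hfail ⟨by omega, by push_cast; exact h⟩
  obtain ⟨b, rfl⟩ : ∃ b, n = m + b := ⟨n - m, by omega⟩
  have hsm : m ^ 2 ≤ s := by
    have : (m : ℝ) ^ 2 ≤ s := by
      push_cast at hmP
      nlinarith [sq_nonneg (b : ℝ)]
    exact_mod_cast this
  obtain ⟨a, rfl⟩ : ∃ a, s = m ^ 2 + a := ⟨s - m ^ 2, by omega⟩
  refine IsSumSquaresWithSum.cons (isSumSquaresWithSum_four ?_ ?_ ?_ ?_) m
  · rw [Nat.odd_iff]
    have : m ^ 2 % 2 = m % 2 := by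
      rcases Nat.mod_two_eq_zero_or_one m with h | h <;> simp [Nat.pow_mod, h]
    omega
  · rw [Nat.odd_iff]; omega
  · have : (b : ℝ) ^ 2 < 4 * a := by push_cast at hmP; nlinarith
    exact_mod_cast this
  · have hb : ε * ((m + b : ℕ) : ℝ) ≤ 2 * b := by
      refine hgap.trans (le_of_eq ?_); push_cast; ring
    have hb2 : (ε * ((m + b : ℕ) : ℝ)) ^ 2 ≤ (2 * b) ^ 2 := by gcongr
    have hb3 : 250 * ((m + b : ℕ) : ℝ) ≤ (b : ℝ) ^ 2 := by nlinarith
    have : (3 * a : ℝ) < b ^ 2 + 2 * b + 4 := by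
      push_cast at hfail' hb3 hn2
      nlinarith
    exact_mod_cast this

/-- With a small `δ`, the values `s ≥ (1 / r + δ) n²` are represented with an additional `0`; the others,
which lie above `n² / (r + 1)`, with an additional `m = ⌊n / (r + 1)⌋`, for which Cauchy-Schwarz is
nearly an equality. -/
theorem RepresentsInterior.succ {r : ℕ} (hr : 5 ≤ r) (h : RepresentsInterior r) :
    RepresentsInterior (r + 1) := by
  intro ε hε
  obtain ⟨δ, hδ⟩ : ∃ δ, δ = min (ε / 2) (1 / 4) := ⟨_, rfl⟩
  have hδ0 : 0 < δ := by rw [hδ]; positivity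
  have hδ1 : δ ≤ ε / 2 := hδ ▸ min_le_left _ _
  have hδ2 : δ ≤ 1 / 4 := hδ ▸ min_le_right _ _
  obtain ⟨N, hN⟩ := eventually_atTop.1 (h δ hδ0)
  have hl : Tendsto (fun n : ℕ => (n : ℝ)) atTop atTop := tendsto_natCast_atTop_atTop
  filter_upwards [eventually_ge_atTop (2 * N), eventually_ge_atTop 1,
    hl.eventually_ge_atTop (10 / ε)] with n hn1 hn0 hn2 s hpar hlo hhi
  rw [div_le_iff₀ (by positivity)] at hn2
  have hn1R : (1 : ℝ) ≤ n := by exact_mod_cast hn0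
  have hrR : (5 : ℝ) ≤ r := by exact_mod_cast hr
  have hrinv : (1 : ℝ) / r ≤ 1 / 5 := one_div_le_one_div_of_le (by norm_num) hrR
  by_cases hs : (1 / r + δ) * (n : ℝ) ^ 2 ≤ s
  · have := (hN n (by omega) s hpar hs (hhi.trans (by gcongr; linarith))).cons 0
    simpa using this
  push Not at hs
  have hmle := Nat.div_mul_le_self n (r + 1)
  have hmlt := Nat.lt_div_mul_add (a := n) (b := r + 1) (by omega)
  obtain ⟨m, hm⟩ : ∃ m, m = n / (r + 1) := ⟨_, rfl⟩
  rw [← hm] at hmle hmlt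
  have hm6 : 6 * m ≤ n := by nlinarith
  obtain ⟨b, rfl⟩ : ∃ b, n = m + b := ⟨n - m, by omega⟩
  have hbm : r * m ≤ b ∧ b ≤ r * m + r := by constructor <;> nlinarith
  have hbm1 : (r * m : ℝ) ≤ b := by exact_mod_cast hbm.1
  have hbm2 : (b : ℝ) ≤ r * m + r := by exact_mod_cast hbm.2
  have hm5 : (5 * m : ℝ) ≤ b := by exact_mod_cast (by omega : 5 * m ≤ b)
  -- The defect in Cauchy-Schwarz is `(b - r m)² / (r (r + 1))`, which is at most `1` for this `m`.
  have hdefect : (m : ℝ) ^ 2 + 1 / r * (b : ℝ) ^ 2 - 1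
      ≤ 1 / (r + 1) * ((m : ℝ) + b) ^ 2 := by
    have h1 : 1 / (r + 1) * ((m : ℝ) + b) ^ 2
        = m ^ 2 + 1 / r * (b : ℝ) ^ 2 - (b - r * m) ^ 2 / (r * (r + 1)) := by
      field_simp; ring
    have h2 : ((b : ℝ) - r * m) ^ 2 / (r * (r + 1)) ≤ 1 := by
      rw [div_le_one (by positivity)]; nlinarith
    linarith
  push_cast at hlo hhi hs hn1R hn2
  have hεn : 1 ≤ (ε - δ) * ((m : ℝ) + b) ^ 2 := by nlinarith
  have hbn : δ * (b : ℝ) ^ 2 ≤ δ * ((m : ℝ) + b) ^ 2 := by gcongr; linarith [m.cast_nonneg (α := ℝ)]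
  have hlow : (m : ℝ) ^ 2 + (1 / r + δ) * (b : ℝ) ^ 2 ≤ s := by linarith
  have hms : m ^ 2 ≤ s := by
    have : (m : ℝ) ^ 2 ≤ s := le_trans (le_add_of_nonneg_right (by positivity)) hlow
    exact_mod_cast this
  obtain ⟨a, rfl⟩ : ∃ a, s = m ^ 2 + a := ⟨s - m ^ 2, by omega⟩
  push_cast at hlow hs
  refine (hN b (by omega) a ?_ (by linarith) ?_).cons m
  · have : m ^ 2 % 2 = m % 2 := by
      rcases Nat.mod_two_eq_zero_or_one m with h | h <;> simp [Nat.pow_mod, h]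
    omega
  · have h1 : ((m : ℝ) + b) ^ 2 ≤ (6 / 5 * b) ^ 2 := by gcongr; linarith
    have h2 : (1 / r + δ) * ((m : ℝ) + b) ^ 2 ≤ (9 / 20) * (6 / 5 * b) ^ 2 := by
      gcongr; linarith
    nlinarith [sq_nonneg (b : ℝ), sq_nonneg (m : ℝ)]

theorem representsInterior_of_five_le {r : ℕ} (hr : 5 ≤ r) : RepresentsInterior r := by
  induction r, hr using Nat.le_induction with
  | base => exact representsInterior_five
  | succ r hr ih => exact ih.succ hr

/-! ### Counting -/

theorem mem_cliqueEdgeCounts_iff {n r e : ℕ} :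
    e ∈ cliqueEdgeCounts n r ↔ IsSumSquaresWithSum r n (2 * e + n) := by
  have key : ∀ a : Fin r → ℕ, ∑ i, a i ^ 2 = 2 * ∑ i, (a i).choose 2 + ∑ i, a i := by
    intro a
    rw [Finset.mul_sum, ← Finset.sum_add_distrib]
    refine Finset.sum_congr rfl fun i _ => ?_
    rw [Nat.choose_two_right, Nat.mul_div_cancel' (Nat.even_mul_pred_self _).two_dvd]
    cases a i <;> simp; ring
  constructor
  · rintro ⟨a, h1, h2⟩
    exact ⟨a, h1, by rw [key, h1, h2]⟩
  · rintro ⟨a, h1, h2⟩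
    refine ⟨a, h1, ?_⟩
    have := key a
    omega

theorem IsSumSquaresWithSum.bounds {r n s : ℕ} (h : IsSumSquaresWithSum r n s) :
    n ^ 2 ≤ r * s ∧ s ≤ n ^ 2 := by
  obtain ⟨a, rfl, rfl⟩ := h
  constructor
  · simpa using sq_sum_le_card_mul_sum_sq (s := Finset.univ) (f := a)
  · exact Finset.sum_sq_le_sq_sum_of_nonneg fun i _ => Nat.zero_le _

theorem ncard_cliqueEdgeCounts_le {n r : ℕ} (hr : 1 ≤ r) (hn : r ≤ n) :
    ((cliqueEdgeCounts n r).ncard : ℝ) ≤ (n : ℝ) ^ 2 / 2 - (n : ℝ) ^ 2 / (2 * r) + 1 := by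
  have hrR : (1 : ℝ) ≤ r := by exact_mod_cast hr
  have hnR : (r : ℝ) ≤ n := by exact_mod_cast hn
  obtain ⟨α, hα⟩ : ∃ α : ℝ, α = ((n : ℝ) ^ 2 / r - n) / 2 := ⟨_, rfl⟩
  obtain ⟨β, hβ⟩ : ∃ β : ℝ, β = ((n : ℝ) ^ 2 - n) / 2 := ⟨_, rfl⟩
  have hβ0 : 0 ≤ β := by rw [hβ]; nlinarith
  have hαβ : α ≤ β := by
    have : (n : ℝ) ^ 2 / r ≤ (n : ℝ) ^ 2 := div_le_self (by positivity) hrR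
    linarith
  have hdiff : β - α = (n : ℝ) ^ 2 / 2 - (n : ℝ) ^ 2 / (2 * r) := by
    rw [hα, hβ]; field_simp; ring
  have hsub : cliqueEdgeCounts n r ⊆ (Finset.Icc ⌈α⌉₊ ⌊β⌋₊ : Set ℕ) := by
    intro e he
    obtain ⟨h1, h2⟩ := (mem_cliqueEdgeCounts_iff.1 he).bounds
    have h1' : (n : ℝ) ^ 2 ≤ r * (2 * e + n) := by exact_mod_cast h1
    have h2' : (2 * e + n : ℝ) ≤ (n : ℝ) ^ 2 := by exact_mod_cast h2
    simp only [Finset.coe_Icc, Set.mem_Icc]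
    refine ⟨Nat.ceil_le.2 ?_, Nat.le_floor ?_⟩
    · have : (n : ℝ) ^ 2 / r ≤ 2 * e + n := by
        rw [div_le_iff₀ (by positivity)]; linarith
      rw [hα]; linarith
    · rw [hβ]; linarith
  have hcard := Set.ncard_le_ncard hsub (Finset.finite_toSet _)
  rw [Set.ncard_coe_finset, Nat.card_Icc] at hcard
  rw [← hdiff]
  refine (Nat.cast_le.2 hcard).trans ?_
  have hc := Nat.le_ceil α
  have hf := Nat.floor_le hβ0
  rcases le_total (⌊β⌋₊ + 1) ⌈α⌉₊ with h | h
  · rw [Nat.sub_eq_zero_of_le h]; push_cast; linarith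
  · rw [Nat.cast_sub h]; push_cast; linarith

theorem eventually_le_ncard_cliqueEdgeCounts {r : ℕ} (hr : 5 ≤ r) {ε : ℝ} (hε : 0 < ε) :
    ∀ᶠ n : ℕ in atTop, (n : ℝ) ^ 2 / 2 - (n : ℝ) ^ 2 / (2 * r) - ε * (n : ℝ) ^ 2 - 1
      ≤ (cliqueEdgeCounts n r).ncard := by
  filter_upwards [representsInterior_of_five_le hr ε hε, eventually_ge_atTop r] with n hn hrn
  have hrR : (5 : ℝ) ≤ r := by exact_mod_cast hr
  have hnR : (r : ℝ) ≤ n := by exact_mod_cast hrn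
  obtain ⟨α, hα⟩ : ∃ α : ℝ, α = ((1 / r + ε) * (n : ℝ) ^ 2 - n) / 2 := ⟨_, rfl⟩
  obtain ⟨β, hβ⟩ : ∃ β : ℝ, β = ((1 - ε) * (n : ℝ) ^ 2 - n) / 2 := ⟨_, rfl⟩
  have hα0 : 0 ≤ α := by
    have : (n : ℝ) ≤ 1 / r * (n : ℝ) ^ 2 := by
      rw [one_div_mul_eq_div, le_div_iff₀ (by positivity)]; nlinarith
    rw [hα]
    nlinarith [mul_nonneg hε.le (sq_nonneg (n : ℝ))]
  have hdiff : β - α = (n : ℝ) ^ 2 / 2 - (n : ℝ) ^ 2 / (2 * r) - ε * (n : ℝ) ^ 2 := by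
    rw [hα, hβ]; field_simp; ring
  -- For `β < 0` the truncation in `⌊β⌋₊` is harmful, but then the bound is trivial.
  rcases lt_or_ge β 0 with hβ0 | hβ0
  · have : (0 : ℝ) ≤ (cliqueEdgeCounts n r).ncard := by positivity
    linarith
  have hsub : (Finset.Icc ⌈α⌉₊ ⌊β⌋₊ : Set ℕ) ⊆ cliqueEdgeCounts n r := by
    intro e he
    simp only [Finset.coe_Icc, Set.mem_Icc] at he
    have h1 := Nat.ceil_le.1 he.1
    have h2 := (Nat.le_floor_iff hβ0).1 he.2
    refine mem_cliqueEdgeCounts_iff.2 (hn _ (by omega) ?_ ?_) <;> push_cast <;> linarith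
  have hcard := Set.ncard_le_ncard hsub (cliqueEdgeCounts_finite n r)
  rw [Set.ncard_coe_finset, Nat.card_Icc] at hcard
  rw [← hdiff]
  refine le_trans ?_ (Nat.cast_le.2 hcard)
  have hc := Nat.ceil_lt_add_one hα0
  have hf := Nat.lt_floor_add_one β
  have : ((⌊β⌋₊ + 1 : ℕ) : ℝ) ≤ ((⌊β⌋₊ + 1 - ⌈α⌉₊ : ℕ) : ℝ) + ⌈α⌉₊ := by
    exact_mod_cast le_tsub_add
  push_cast at this
  linarith

theorem theorem4p3 (r : ℕ) (hr : 5 ≤ r) :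
    (fun n : ℕ => ((cliqueEdgeCounts n r).ncard : ℝ)
        - ((n : ℝ) ^ 2 / 2 - (n : ℝ) ^ 2 / (2 * (r : ℝ))))
      =o[atTop] (fun n : ℕ => (n : ℝ) ^ 2) := by
  rw [isLittleO_iff]
  intro c hc
  have hl : Tendsto (fun n : ℕ => (n : ℝ)) atTop atTop := tendsto_natCast_atTop_atTop
  filter_upwards [eventually_le_ncard_cliqueEdgeCounts hr (half_pos hc), eventually_ge_atTop r,
    hl.eventually_ge_atTop (2 / c), hl.eventually_ge_atTop 1] with n hlo hrn hn hn1
  have hup := ncard_cliqueEdgeCounts_le (by omega) hrn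
  rw [div_le_iff₀ hc] at hn
  have hcn : 1 ≤ c / 2 * (n : ℝ) ^ 2 := by nlinarith
  rw [Real.norm_eq_abs, Real.norm_of_nonneg (sq_nonneg _), abs_le]
  constructor <;> linarith
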